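/- Let $d\ge 1$. A quantum state on $\mathbb{C}^d$ is a positive semidefinite $d\times d$ complex matrix of trace one. For $\psi\in\mathbb{C}P^{d-1}$ let $\pi(\psi)$ be the orthogonal projector onto the line $\psi$. A POVM $F$ on a measurable space $\mathscr{X}$ is a countably additive map from the measurable subsets of $\mathscr{X}$ to the positive semidefinite $d\times d$ matrices with $F(\mathscr{X})=I$. Its trace measure is $\tau(\mathscr{S})=\operatorname{tr}[F(\mathscr{S})]$, and its density $P=\mathrm{d}F/\mathrm{d}\tau$ is the Radon–Nikodym derivative, determined up to $\tau$-null sets by $F(\mathscr{S})=\int_{\mathscr{S}}P\,\mathrm{d}\tau$. $F$ is *rank-one* if $P(x)$ has rank one for $\tau$-almost every $x$. $F$ is a *tight IC-POVM* if for some constant $a>0$ $$\int_{\mathscr{X}}\mathrm{d}\tau(x)\,\operatorname{tr}\!\big[(P(x)-I/d)^\dagger A\big]\,(P(x)-I/d)\;=\;a\,A$$ for every traceless Hermitian $d\times d$ matrix $A$. A tight rank-one IC-POVM is one with both properties. **Theorem.** Let $F$ be a POVM on $\mathscr{X}$ with values in the $d\times d$ matrices, and let $\hat\rho$ be a ($\tau$-measurable)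 map from $\mathscr{X}$ to the quantum states on $\mathbb{C}^d$, i.e. let $(F,\hat\rho)$ be a measurement-based cloning strategy. Then $$f_{\mathrm{wc}}^{(F,\hat\rho)}\;\equiv\;\inf_{\psi\in\mathbb{C}P^{d-1}}\int_{\mathscr{X}}\operatorname{tr}[\mathrm{d}F(x)\,\pi(\psi)]\,\operatorname{tr}[\hat\rho(x)\,\pi(\psi)]\;\le\;\frac{2}{d+1},$$ with equality if and only if $F$ is a tight rank-one IC-POVM and $\hat\rho=P$ $\tau$-almost everywhere. -/

import Mathlib

open MeasureTheory Matrix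
open scoped ComplexOrder

noncomputable section

/-- A quantum state on `ℂ^d`: a positive semidefinite matrix of trace one. -/
def IsQuantumState {d : ℕ} (ρ : Matrix (Fin d) (Fin d) ℂ) : Prop :=
  ρ.PosSemidef ∧ ρ.trace = 1

/-- The rank-one projector `π(ψ) = |v⟩⟨v| / ⟨v|v⟩` of a point `ψ` of the complex projective space
`ℂP^{d-1}`, where `v` is any nonzero vector on the line `ψ` (see `pureProj_mk`). -/
def pureProj {d : ℕ} (ψ : Projectivization ℂ (Fin d → ℂ)) : Matrix (Fin d) (Fin d) ℂ :=
  (star ψ.rep ⬝ᵥ ψ.rep)⁻¹ • vecMulVec ψ.rep (star ψ.rep)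

theorem pureProj_mk {d : ℕ} (v : Fin d → ℂ) (hv : v ≠ 0) :
    pureProj (Projectivization.mk ℂ v hv) = (star v ⬝ᵥ v)⁻¹ • vecMulVec v (star v) := by
  obtain ⟨a, ha⟩ := Projectivization.exists_smul_eq_mk_rep ℂ v hv
  have ha0 : (a : ℂ) ≠ 0 := a.ne_zero
  have hs : star (a : ℂ) ≠ 0 := star_ne_zero.mpr ha0
  unfold pureProj
  rw [← ha, Units.smul_def]
  simp only [star_smul, smul_dotProduct, dotProduct_smul, vecMulVec_smul, smul_vecMulVec,
    smul_smul, smul_eq_mul]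
  congr 1
  field_simp

theorem pureProj_posSemidef {d : ℕ} (ψ : Projectivization ℂ (Fin d → ℂ)) :
    (pureProj ψ).PosSemidef :=
  (posSemidef_vecMulVec_self_star ψ.rep).smul
    (inv_nonneg.mpr (dotProduct_star_self_nonneg ψ.rep))

theorem pureProj_isQuantumState {d : ℕ} (ψ : Projectivization ℂ (Fin d → ℂ)) :
    IsQuantumState (pureProj ψ) := by
  refine ⟨pureProj_posSemidef ψ, ?_⟩
  have h : star ψ.rep ⬝ᵥ ψ.rep ≠ 0 := fun h => ψ.rep_nonzero (dotProduct_star_self_eq_zero.mp h)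
  rw [pureProj, trace_smul, trace_vecMulVec, dotProduct_comm ψ.rep, smul_eq_mul,
    inv_mul_cancel₀ h]

/-- A positive-operator-valued measure (POVM) on a measurable space `X` with values in the
`d × d` complex matrices: a countably additive matrix-valued set function on the measurable sets
with positive semidefinite values and total mass `I`. -/
structure POVM (X : Type*) [MeasurableSpace X] (d : ℕ) where
  /-- the underlying countably additive matrix-valued measure -/
  toVectorMeasure : VectorMeasure X (Matrix (Fin d) (Fin d) ℂ)
  posSemidef : ∀ S : Set X, MeasurableSet S → (toVectorMeasure S).PosSemidef
  univ_eq_one : toVectorMeasure Set.univ = 1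

namespace POVM

variable {X : Type*} [MeasurableSpace X] {d : ℕ}

theorem re_trace_mul_nonneg {A B : Matrix (Fin d) (Fin d) ℂ} (hA : A.PosSemidef)
    (hB : B.PosSemidef) : 0 ≤ (A * B).trace.re := by
  obtain ⟨m, v, rfl⟩ := posSemidef_iff_eq_sum_vecMulVec.mp hB
  rw [Matrix.mul_sum, trace_sum, Complex.re_sum]
  refine Finset.sum_nonneg fun i _ => ?_
  rw [mul_vecMulVec, trace_vecMulVec, dotProduct_comm]
  exact (Complex.le_def.mp (hA.dotProduct_mulVec_nonneg (v i))).1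

/-- The finite positive measure `S ↦ tr[F(S) A]` attached to a positive semidefinite matrix `A`.
For a quantum state `A` it is the probability distribution of the outcome of the measurement. -/
def traceMulMeasure (F : POVM X d) (A : Matrix (Fin d) (Fin d) ℂ) (hA : A.PosSemidef) :
    Measure X :=
  Measure.ofMeasurable (fun S _ => ENNReal.ofReal (F.toVectorMeasure S * A).trace.re)
    (by simp)
    (by
      intro f hf hd
      have hc : Continuous fun M : Matrix (Fin d) (Fin d) ℂ => (M * A).trace.re := by fun_prop
      have h := (F.toVectorMeasure.m_iUnion hf hd).map
        (Complex.reAddGroupHom.comp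
          ((traceAddMonoidHom (Fin d) ℂ).comp (AddMonoidHom.mulRight A))) hc
      have h' : HasSum (fun i => (F.toVectorMeasure (f i) * A).trace.re)
          (F.toVectorMeasure (⋃ i, f i) * A).trace.re := h
      rw [← h'.tsum_eq]
      exact ENNReal.ofReal_tsum_of_nonneg
        (fun i => re_trace_mul_nonneg (F.posSemidef _ (hf i)) hA) h'.summable)

theorem traceMulMeasure_apply (F : POVM X d) (A : Matrix (Fin d) (Fin d) ℂ) (hA : A.PosSemidef)
    {S : Set X} (hS : MeasurableSet S) :
    F.traceMulMeasure A hA S = ENNReal.ofReal (F.toVectorMeasure S * A).trace.re :=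
  Measure.ofMeasurable_apply S hS

instance (F : POVM X d) (A : Matrix (Fin d) (Fin d) ℂ) (hA : A.PosSemidef) :
    IsFiniteMeasure (F.traceMulMeasure A hA) :=
  ⟨by rw [traceMulMeasure_apply F A hA MeasurableSet.univ]; exact ENNReal.ofReal_lt_top⟩

/-- The trace measure `τ(S) = tr[F(S)]`. -/
def traceMeasure (F : POVM X d) : Measure X := F.traceMulMeasure 1 PosSemidef.one

theorem traceMeasure_apply (F : POVM X d) {S : Set X} (hS : MeasurableSet S) :
    F.traceMeasure S = ENNReal.ofReal (F.toVectorMeasure S).trace.re := by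
  rw [traceMeasure, traceMulMeasure_apply F _ _ hS, Matrix.mul_one]

instance (F : POVM X d) : IsFiniteMeasure F.traceMeasure := by
  unfold traceMeasure; infer_instance

/-- The complex measure `S ↦ F(S)ᵢⱼ`. -/
def entry (F : POVM X d) (i j : Fin d) : ComplexMeasure X :=
  F.toVectorMeasure.mapRange (entryAddMonoidHom ℂ i j)
    (show Continuous fun M : Matrix (Fin d) (Fin d) ℂ => M i j by fun_prop)

/-- The positive-operator-valued density `P` of `F`: the (entrywise) Radon-Nikodym derivative of
`F` with respect to its trace measure. It is determined up to `τ`-null sets by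
`F(S) = ∫_S P dτ` (see `setIntegral_povd`). -/
def povd (F : POVM X d) (x : X) : Matrix (Fin d) (Fin d) ℂ :=
  Matrix.of fun i j => (F.entry i j).rnDeriv F.traceMeasure x

theorem integrable_povd (F : POVM X d) (i j : Fin d) :
    Integrable (fun x => F.povd x i j) F.traceMeasure :=
  ComplexMeasure.integrable_rnDeriv _ _

theorem toVectorMeasure_eq_zero (F : POVM X d) {S : Set X} (hS : MeasurableSet S)
    (h : F.traceMeasure S = 0) : F.toVectorMeasure S = 0 := by
  rw [traceMeasure_apply F hS, ENNReal.ofReal_eq_zero] at h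
  have hp := F.posSemidef S hS
  have h0 := Complex.le_def.mp hp.trace_nonneg
  exact hp.trace_eq_zero_iff.mp (Complex.ext (le_antisymm h h0.1) h0.2.symm)

theorem setIntegral_povd (F : POVM X d) {S : Set X} (hS : MeasurableSet S) (i j : Fin d) :
    ∫ x in S, F.povd x i j ∂F.traceMeasure = F.toVectorMeasure S i j := by
  have key : ∀ s : SignedMeasure X,
      (∀ T, MeasurableSet T → F.traceMeasure T = 0 → s T = 0) →
      ∫ x in S, s.rnDeriv F.traceMeasure x ∂F.traceMeasure = s S := by
    intro s hs
    have hac : s ≪ᵥ F.traceMeasure.toENNRealVectorMeasure :=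
      VectorMeasure.AbsolutelyContinuous.mk fun T hT h0 => hs T hT (by
        rwa [Measure.toENNRealVectorMeasure_apply_measurable hT] at h0)
    have h := (SignedMeasure.absolutelyContinuous_iff_withDensityᵥ_rnDeriv_eq s
      F.traceMeasure).mp hac
    conv_rhs => rw [← h]
    rw [withDensityᵥ_apply (SignedMeasure.integrable_rnDeriv _ _) hS]
  have hz : ∀ T, MeasurableSet T → F.traceMeasure T = 0 → F.entry i j T = 0 := by
    intro T hT h0
    change F.toVectorMeasure T i j = 0
    rw [F.toVectorMeasure_eq_zero hT h0]; rfl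
  have hre := key (F.entry i j).re fun T hT h0 => by
    change (F.entry i j T).re = 0
    rw [hz T hT h0]; rfl
  have him := key (F.entry i j).im fun T hT h0 => by
    change (F.entry i j T).im = 0
    rw [hz T hT h0]; rfl
  have hint := (F.integrable_povd i j).integrableOn (s := S)
  apply Complex.ext
  · have := integral_re hint
    exact this.symm.trans hre
  · have := integral_im hint
    exact this.symm.trans him

/-- `F` is a rank-one POVM: its density has rank one almost everywhere. -/
def IsRankOne (F : POVM X d) : Prop :=
  ∀ᵐ x ∂F.traceMeasure, (F.povd x).rank = 1

/-- The traceless part `P(x) - I/d` of the density. -/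
def tracelessPovd (F : POVM X d) (x : X) : Matrix (Fin d) (Fin d) ℂ :=
  F.povd x - (d : ℂ)⁻¹ • (1 : Matrix (Fin d) (Fin d) ℂ)

/-- `F` is a tight IC-POVM: `P - I/d` is a tight operator frame, with respect to the trace measure,
in the space of traceless Hermitian matrices with the Hilbert-Schmidt inner product
`⟨A, B⟩ = tr(Aᴴ B)`. That is, for some `a > 0`,
`∫ (P(x) - I/d) tr[(P(x) - I/d)ᴴ A] dτ(x) = a A` for all traceless Hermitian `A`
(the matrix-valued integral is taken entrywise). -/
def IsTightIC (F : POVM X d) : Prop :=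
  ∃ a : ℝ, 0 < a ∧ ∀ A : Matrix (Fin d) (Fin d) ℂ, A.IsHermitian → A.trace = 0 →
    ∀ i j : Fin d,
      ∫ x, ((F.tracelessPovd x)ᴴ * A).trace * F.tracelessPovd x i j ∂F.traceMeasure
        = (a : ℂ) * A i j

/-- The success probability `f(ψ) = ∫ tr[dF(x) π(ψ)] tr[ρ(x) π(ψ)]` for cloning the pure state
`ψ`. -/
def fidelity (F : POVM X d) (ρ : X → Matrix (Fin d) (Fin d) ℂ)
    (ψ : Projectivization ℂ (Fin d → ℂ)) : ℝ :=
  ∫ x, (ρ x * pureProj ψ).trace.re ∂F.traceMulMeasure (pureProj ψ) (pureProj_posSemidef ψ)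

/-- The worst-case success probability, the infimum of `f(ψ)` over all pure states. -/
def worstCaseFidelity (F : POVM X d) (ρ : X → Matrix (Fin d) (Fin d) ℂ) : ℝ :=
  ⨅ ψ : Projectivization ℂ (Fin d → ℂ), F.fidelity ρ ψ

end POVM

end

/-! The worst case is bounded by an average. Over a weighted projective 2-design of total weight
d(d+1), the products tr[Aπ] tr[Bπ] sum to tr A tr B + tr AB. The density P is almost everywhere a
state and τ has mass d, so the fidelities sum to d + ∫ tr[Pρ] dτ (`POVM.sum_mul_fidelity`). An
overlap of two states is at most 1, hence this is at most 2d, and the infimum is at most 2/(d+1).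

For the equality case, finite designs can replace Haar measure because every ψ lies in one with
positive weight (`exists_weighted_two_design`). Saturation therefore forces the fidelity to be
constant at every ψ, with no continuity argument, and forces tr[Pρ] = 1 almost everywhere, so that P
= ρ is pure. The quadratic moments ∫ tr[Pπ]² dτ are then constant in π, and polarisation in the form
of `POVM.integral_povd_mul_povd` shows that ∫ P ⊗ P dτ is a multiple of identity plus swap, which
yields tightness.

Conversely, tightness together with ρ = P makes the fidelity constant, and the design average, with
tr P² = 1 from rank one, identifies the constant as 2/(d+1). -/

/-! ### A finite 2-design from phase vectors and a basis. -/

theorem star_mul_self_rootsOfUnity_four (z : rootsOfUnity 4 ℂ) :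
    star ((z : ℂˣ) : ℂ) * ((z : ℂˣ) : ℂ) = 1 := by
  have h4 : ((z : ℂˣ) : ℂ) ^ 4 = 1 := (mem_rootsOfUnity' 4 (z : ℂˣ)).mp z.2
  have hn : ‖((z : ℂˣ) : ℂ)‖ = 1 := Complex.norm_eq_one_of_pow_eq_one h4 (by norm_num)
  rw [Complex.star_def, ← Complex.normSq_eq_conj_mul_self, Complex.normSq_eq_norm_sq, hn]
  simp

/-- The sum over all phase vectors of a monomial of bidegree `(2, 2)`. -/
theorem sum_phase_monomial {n : Type*} [Fintype n] [DecidableEq n]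
    [Fintype (rootsOfUnity 4 ℂ)] (i j k l : n) :
    ∑ s : n → rootsOfUnity 4 ℂ, star ((s i : ℂˣ) : ℂ) * ((s j : ℂˣ) : ℂ) *
        (star ((s k : ℂˣ) : ℂ) * ((s l : ℂˣ) : ℂ)) =
      (Fintype.card (n → rootsOfUnity 4 ℂ) : ℂ) *
        ((if i = j ∧ k = l then 1 else 0) + (if i = l ∧ k = j then 1 else 0) -
          if i = j ∧ k = l ∧ i = k then 1 else 0) := by
  -- Translating the summation variable by t multiplies the sum by the value of the monomial at t;
  -- if that value is not 1, the sum vanishes.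
  have hshift : ∀ t : n → rootsOfUnity 4 ℂ,
      star ((t i : ℂˣ) : ℂ) * ((t j : ℂˣ) : ℂ) *
        (star ((t k : ℂˣ) : ℂ) * ((t l : ℂˣ) : ℂ)) ≠ 1 →
      ∑ s : n → rootsOfUnity 4 ℂ, star ((s i : ℂˣ) : ℂ) * ((s j : ℂˣ) : ℂ) *
        (star ((s k : ℂˣ) : ℂ) * ((s l : ℂˣ) : ℂ)) = 0 := by
    intro t ht
    have h := Equiv.sum_comp (Equiv.mulLeft t) fun s : n → rootsOfUnity 4 ℂ =>
      star ((s i : ℂˣ) : ℂ) * ((s j : ℂˣ) : ℂ) * (star ((s k : ℂˣ) : ℂ) * ((s l : ℂˣ) : ℂ))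
    set T := ∑ s : n → rootsOfUnity 4 ℂ, star ((s i : ℂˣ) : ℂ) * ((s j : ℂˣ) : ℂ) *
        (star ((s k : ℂˣ) : ℂ) * ((s l : ℂˣ) : ℂ)) with hT
    have h2 : (star ((t i : ℂˣ) : ℂ) * ((t j : ℂˣ) : ℂ) *
        (star ((t k : ℂˣ) : ℂ) * ((t l : ℂˣ) : ℂ))) * T = T := by
      conv_rhs => rw [← h]
      rw [hT, Finset.mul_sum]
      refine Finset.sum_congr rfl fun s _ => ?_
      simp only [Equiv.coe_mulLeft, Pi.mul_apply, Subgroup.coe_mul, Units.val_mul, star_mul']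
      ring
    have h3 : (star ((t i : ℂˣ) : ℂ) * ((t j : ℂˣ) : ℂ) *
        (star ((t k : ℂˣ) : ℂ) * ((t l : ℂˣ) : ℂ)) - 1) * T = 0 := by rw [sub_mul, h2]; ring
    exact (mul_eq_zero.mp h3).resolve_left (sub_ne_zero.mpr ht)
  -- In each vanishing case t is ζ at one index and 1 elsewhere. Signs ±1 would not do, since a
  -- conjugated variable may occur squared.
  obtain ⟨ζ, hζ⟩ : ∃ ζ : rootsOfUnity 4 ℂ, ((ζ : ℂˣ) : ℂ) = Complex.I :=
    ⟨⟨Units.mk0 Complex.I Complex.I_ne_zero, by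
      rw [mem_rootsOfUnity']; simp⟩, rfl⟩
  have hI1 : -Complex.I ≠ 1 := fun h => by simpa using congrArg Complex.re h
  by_cases hij : i = j
  · subst hij
    by_cases hkl : k = l
    · subst hkl
      simp only [star_mul_self_rootsOfUnity_four, true_and, mul_one, Finset.sum_const, Finset.card_univ, nsmul_eq_mul]
      by_cases hik : i = k <;> simp [hik, eq_comm]
    · rw [hshift (Pi.mulSingle k ζ) ?_]
      · by_cases hil : i = l
        · subst hil; simp [hkl]
        · simp [hkl, hil]
      · rw [star_mul_self_rootsOfUnity_four, one_mul]
        simpa [Pi.mulSingle_eq_of_ne (Ne.symm hkl), hζ] using hI1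
  · by_cases hil : i = l
    · subst hil
      by_cases hkj : k = j
      · subst hkj
        simp only [hij, false_and, if_false, and_self, if_true, zero_add, sub_zero, mul_one]
        rw [Finset.sum_congr rfl (g := fun _ => (1 : ℂ))]
        · simp
        · intro s _
          linear_combination (star ((s k : ℂˣ) : ℂ) * ((s k : ℂˣ) : ℂ)) * star_mul_self_rootsOfUnity_four (s i) + star_mul_self_rootsOfUnity_four (s k)
      · rw [hshift (Pi.mulSingle k ζ) ?_]
        · simp [hij, hkj]
        · rw [mul_comm (star (((Pi.mulSingle k ζ : n → rootsOfUnity 4 ℂ) k : ℂˣ) : ℂ)), mul_mul_mul_comm,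
            star_mul_self_rootsOfUnity_four, one_mul]
          simpa [Pi.mulSingle_eq_of_ne (Ne.symm hkj), hζ] using hI1
    · rw [hshift (Pi.mulSingle i ζ) ?_]
      · simp [hij, hil]
      · rw [Pi.mulSingle_eq_of_ne (Ne.symm hij), Pi.mulSingle_eq_of_ne (Ne.symm hil)]
        -- If i = k the monomial contains the square of the conjugate, with value (-I)² = -1;
        -- otherwise its value is -I.
        by_cases hik : i = k
        · subst hik; simp [hζ]; norm_num
        · simpa [Pi.mulSingle_eq_of_ne (Ne.symm hik), hζ] using hI1

/-- The surviving index pairings are i = j, k = l and i = l, k = j, giving the two trace terms;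
their overlap is counted twice, whence the diagonal correction. That correction is exactly what the
basis vectors restore in the 2-design. -/
theorem sum_phase_quadratic_mul {n : Type*} [Fintype n] [DecidableEq n]
    [Fintype (rootsOfUnity 4 ℂ)] (A B : Matrix n n ℂ) :
    ∑ s : n → rootsOfUnity 4 ℂ,
        ((star fun i => ((s i : ℂˣ) : ℂ)) ⬝ᵥ A *ᵥ fun i => ((s i : ℂˣ) : ℂ)) *
          ((star fun i => ((s i : ℂˣ) : ℂ)) ⬝ᵥ B *ᵥ fun i => ((s i : ℂˣ) : ℂ)) =
      (Fintype.card (n → rootsOfUnity 4 ℂ) : ℂ) *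
        (A.trace * B.trace + (A * B).trace - ∑ i, A i i * B i i) := by
  have h1 : ∀ s : n → rootsOfUnity 4 ℂ,
      ((star fun i => ((s i : ℂˣ) : ℂ)) ⬝ᵥ A *ᵥ fun i => ((s i : ℂˣ) : ℂ)) *
          ((star fun i => ((s i : ℂˣ) : ℂ)) ⬝ᵥ B *ᵥ fun i => ((s i : ℂˣ) : ℂ)) =
      ∑ i, ∑ k, ∑ j, ∑ l, A i j * B k l * (star ((s i : ℂˣ) : ℂ) * ((s j : ℂˣ) : ℂ) *
        (star ((s k : ℂˣ) : ℂ) * ((s l : ℂˣ) : ℂ))) := by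
    intro s
    simp only [dotProduct, mulVec, Pi.star_apply]
    rw [Finset.sum_mul_sum]
    refine Finset.sum_congr rfl fun i _ => Finset.sum_congr rfl fun k _ => ?_
    rw [mul_mul_mul_comm, Finset.sum_mul_sum, Finset.mul_sum]
    refine Finset.sum_congr rfl fun j _ => ?_
    rw [Finset.mul_sum]
    refine Finset.sum_congr rfl fun l _ => ?_
    ring
  simp_rw [h1]
  simp_rw [Finset.sum_comm (s := (Finset.univ : Finset (n → rootsOfUnity 4 ℂ))), ← Finset.mul_sum,
    sum_phase_monomial]
  simp_rw [mul_left_comm _ ((Fintype.card (n → rootsOfUnity 4 ℂ) : ℕ) : ℂ), ← Finset.mul_sum]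
  congr 1
  simp only [mul_add, mul_sub, Finset.sum_add_distrib, Finset.sum_sub_distrib, ite_and, mul_ite,
    mul_one, mul_zero, Finset.sum_ite_eq, Finset.mem_univ, if_true,
    Finset.sum_ite_irrel, Finset.sum_const_zero]
  simp only [trace, diag_apply, Matrix.mul_apply, Finset.sum_mul_sum]

theorem trace_mul_pureProj_mk {d : ℕ} (A : Matrix (Fin d) (Fin d) ℂ) (v : Fin d → ℂ)
    (hv : v ≠ 0) : (A * pureProj (Projectivization.mk ℂ v hv)).trace =
      (star v ⬝ᵥ v)⁻¹ * (star v ⬝ᵥ A *ᵥ v) := by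
  rw [pureProj_mk, Matrix.mul_smul, trace_smul, mul_vecMulVec, trace_vecMulVec, smul_eq_mul,
    dotProduct_comm (A *ᵥ v)]

/-- Every nonzero vector is proportional to a column of a unitary matrix. -/
theorem exists_unitary_column {d : ℕ} (ψ : Projectivization ℂ (Fin d → ℂ)) :
    ∃ (U : Matrix (Fin d) (Fin d) ℂ) (i : Fin d) (h : U.col i ≠ 0), Uᴴ * U = 1 ∧
      Projectivization.mk ℂ (U.col i) h = ψ := by
  classical
  induction ψ using Projectivization.ind with | h v hv => ?_
  have hd : 0 < d := by
    rcases Nat.eq_zero_or_pos d with rfl | h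
    · exact absurd (Subsingleton.elim v 0) hv
    · exact h
  let m : Fin d := ⟨0, hd⟩
  let u : EuclideanSpace ℂ (Fin d) := WithLp.toLp 2 v
  have hu : u ≠ 0 := fun h => hv (by simpa [u] using congrArg WithLp.ofLp h)
  have hn : ((‖u‖ : ℂ))⁻¹ ≠ 0 := inv_ne_zero (by simpa using hu)
  -- The family is constant because only its value at m matters: orthonormality is required on {m}
  -- alone.
  obtain ⟨b, hb⟩ := Orthonormal.exists_orthonormalBasis_extension_of_card_eq (𝕜 := ℂ)
    (ι := Fin d) (E := EuclideanSpace ℂ (Fin d)) (by simp)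
    (v := fun _ => ((‖u‖ : ℂ))⁻¹ • u) (s := {m}) (by
      rw [orthonormal_subsingleton_iff]
      intro i
      simp [norm_smul, hu])
  have hbm : (b m).ofLp = ((‖u‖ : ℂ))⁻¹ • v := by rw [hb m rfl]; rfl
  have hne : (Matrix.of fun i j => b j i).col m ≠ 0 := by
    change (b m).ofLp ≠ 0
    rw [hbm]
    exact smul_ne_zero hn hv
  refine ⟨Matrix.of fun i j => b j i, m, hne, ?_, ?_⟩
  · ext i j
    have := orthonormal_iff_ite.mp b.orthonormal i j
    rw [PiLp.inner_apply] at this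
    rw [Matrix.mul_apply, Matrix.one_apply, ← this]
    simp [mul_comm]
  · rw [Projectivization.mk_eq_mk_iff']
    exact ⟨((‖u‖ : ℂ))⁻¹, hbm.symm⟩

/-- A finite weighted complex projective 2-design that contains a given point. -/
theorem exists_weighted_two_design {d : ℕ} (ψ : Projectivization ℂ (Fin d → ℂ)) :
    ∃ (ι : Type) (_ : Fintype ι) (w : ι → ℝ) (φ : ι → Projectivization ℂ (Fin d → ℂ)) (i₀ : ι),
      (∀ i, 0 ≤ w i) ∧ 0 < w i₀ ∧ φ i₀ = ψ ∧ ∑ i, w i = d * (d + 1) ∧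
      ∀ A B : Matrix (Fin d) (Fin d) ℂ,
        ∑ i, (w i : ℂ) * ((A * pureProj (φ i)).trace * (B * pureProj (φ i)).trace) =
          A.trace * B.trace + (A * B).trace := by
  classical
  obtain ⟨U, m, hm, hU, rfl⟩ := exists_unitary_column ψ
  have : Fintype (rootsOfUnity 4 ℂ) := Fintype.ofFinite _
  have hd : (d : ℂ) ≠ 0 := by
    rintro h
    obtain rfl : d = 0 := by exact_mod_cast h
    exact m.elim0
  have hq : ∀ x : Fin d → ℂ, star (U *ᵥ x) ⬝ᵥ (U *ᵥ x) = star x ⬝ᵥ x := by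
    intro x
    rw [star_mulVec, ← dotProduct_mulVec, mulVec_mulVec, hU, one_mulVec]
  have hne : ∀ x : Fin d → ℂ, x ≠ 0 → U *ᵥ x ≠ 0 := by
    intro x hx h
    have := hq x
    rw [h] at this
    simp at this
    exact hx (dotProduct_star_self_eq_zero.mp this.symm)
  have htr : ∀ (A : Matrix (Fin d) (Fin d) ℂ) (x : Fin d → ℂ) (h : U *ᵥ x ≠ 0),
      (A * pureProj (Projectivization.mk ℂ (U *ᵥ x) h)).trace =
        (star x ⬝ᵥ x)⁻¹ * (star x ⬝ᵥ (Uᴴ * A * U) *ᵥ x) := by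
    intro A x h
    rw [trace_mul_pureProj_mk, hq, star_mulVec, ← dotProduct_mulVec, mulVec_mulVec, mulVec_mulVec,
      Matrix.mul_assoc]
  have hs0 : ∀ s : Fin d → rootsOfUnity 4 ℂ,
      (star fun i => ((s i : ℂˣ) : ℂ)) ⬝ᵥ (fun i => ((s i : ℂˣ) : ℂ)) = d := by
    intro s
    simp only [dotProduct, Pi.star_apply, star_mul_self_rootsOfUnity_four]
    simp
  have hsne : ∀ s : Fin d → rootsOfUnity 4 ℂ, (fun i => ((s i : ℂˣ) : ℂ)) ≠ 0 := by
    intro s h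
    have := congrFun h m
    simp at this
  have hene : ∀ i : Fin d, (Pi.single i 1 : Fin d → ℂ) ≠ 0 := fun i h => by
    simpa using congrFun h i
  set N := Fintype.card (Fin d → rootsOfUnity 4 ℂ) with hN
  have hN0 : (N : ℂ) ≠ 0 := by
    rw [hN]; exact_mod_cast Fintype.card_ne_zero
  -- Phase vectors have squared norm d, so d² cancels the two normalisations and 1/N averages over
  -- them. Basis vectors get weight 1, for a total of d² + d. Rotation by U puts the given point at
  -- the m-th basis vector.
  refine ⟨(Fin d → rootsOfUnity 4 ℂ) ⊕ Fin d, inferInstance,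
    Sum.elim (fun _ => (d : ℝ) ^ 2 / N) (fun _ => 1),
    Sum.elim (fun s => Projectivization.mk ℂ (U *ᵥ fun i => ((s i : ℂˣ) : ℂ)) (hne _ (hsne s)))
      (fun i => Projectivization.mk ℂ (U *ᵥ Pi.single i 1) (hne _ (hene i))),
    Sum.inr m, ?_, ?_, ?_, ?_, ?_⟩
  · rintro (s | i)
    · simp only [Sum.elim_inl]
      positivity
    · simp
  · simp
  · simp
  · have hN0' : (N : ℝ) ≠ 0 := by exact_mod_cast hN0
    rw [Fintype.sum_sum_type]
    simp only [Sum.elim_inl, Sum.elim_inr, Finset.sum_const, Finset.card_univ, ← hN, nsmul_eq_mul,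
      Fintype.card_fin]
    field_simp
  · intro A B
    rw [Fintype.sum_sum_type]
    simp only [Sum.elim_inl, Sum.elim_inr, htr, hs0]
    have hU' : U * Uᴴ = 1 := mul_eq_one_comm.mp hU
    have hA : (Uᴴ * A * U).trace = A.trace := by
      rw [Matrix.trace_mul_comm, ← Matrix.mul_assoc, hU', Matrix.one_mul]
    have hB : (Uᴴ * B * U).trace = B.trace := by
      rw [Matrix.trace_mul_comm, ← Matrix.mul_assoc, hU', Matrix.one_mul]
    have hAB : ((Uᴴ * A * U) * (Uᴴ * B * U)).trace = (A * B).trace := by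
      have : (Uᴴ * A * U) * (Uᴴ * B * U) = Uᴴ * (A * (U * Uᴴ) * B * U) := by
        simp only [Matrix.mul_assoc]
      rw [this, hU', Matrix.mul_one, Matrix.trace_mul_comm, Matrix.mul_assoc, hU', Matrix.mul_one]
    have key := sum_phase_quadratic_mul (Uᴴ * A * U) (Uᴴ * B * U)
    rw [hA, hB, hAB] at key
    have h1 : ∀ x y : ℂ, (((d : ℝ) ^ 2 / N : ℝ) : ℂ) * ((d : ℂ)⁻¹ * x * ((d : ℂ)⁻¹ * y)) =
        (N : ℂ)⁻¹ * (x * y) := by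
      intro x y
      push_cast
      field_simp
    simp_rw [h1]
    rw [← Finset.mul_sum, key, ← hN, inv_mul_cancel_left₀ hN0]
    simp

/-! ### Purity and overlaps of quantum states. -/

theorem trace_mul_self_eq_sum_eigenvalues {n : Type*} [Fintype n] [DecidableEq n]
    {A : Matrix n n ℂ} (hA : A.IsHermitian) :
    (A * A).trace = ∑ i, (hA.eigenvalues i : ℂ) ^ 2 := by
  have h := hA.spectral_theorem
  calc (A * A).trace = (Unitary.conjStarAlgAut ℂ _ hA.eigenvectorUnitary
          (diagonal (RCLike.ofReal ∘ hA.eigenvalues)) *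
        Unitary.conjStarAlgAut ℂ _ hA.eigenvectorUnitary
          (diagonal (RCLike.ofReal ∘ hA.eigenvalues))).trace := by rw [← h]
    _ = _ := by
      rw [← map_mul, Unitary.conjStarAlgAut_apply, Matrix.trace_mul_comm, ← Matrix.mul_assoc,
        Unitary.coe_star_mul_self, Matrix.one_mul, diagonal_mul_diagonal, trace_diagonal]
      simp [sq]

theorem im_trace_mul_eq_zero {n : Type*} [Fintype n] {A B : Matrix n n ℂ} (hA : A.IsHermitian)
    (hB : B.IsHermitian) : (A * B).trace.im = 0 := by
  have h : star (A * B).trace = (A * B).trace := by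
    rw [← trace_conjTranspose, conjTranspose_mul, hA.eq, hB.eq, Matrix.trace_mul_comm]
  exact Complex.conj_eq_iff_im.mp h

theorem ofReal_re_trace_mul {n : Type*} [Fintype n] {A B : Matrix n n ℂ} (hA : A.IsHermitian)
    (hB : B.IsHermitian) : (((A * B).trace.re : ℝ) : ℂ) = (A * B).trace :=
  Complex.ext rfl (im_trace_mul_eq_zero hA hB).symm

namespace IsQuantumState

variable {d : ℕ} {A B : Matrix (Fin d) (Fin d) ℂ}

theorem sum_eigenvalues (hA : IsQuantumState A) : ∑ i, hA.1.1.eigenvalues i = 1 := by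
  have h : ((∑ i, hA.1.1.eigenvalues i : ℝ) : ℂ) = 1 := by
    rw [Complex.ofReal_sum]
    exact hA.1.1.trace_eq_sum_eigenvalues.symm.trans hA.2
  exact_mod_cast h

theorem re_trace_mul_self (hA : IsQuantumState A) :
    (A * A).trace.re = ∑ i, hA.1.1.eigenvalues i ^ 2 := by
  rw [trace_mul_self_eq_sum_eigenvalues hA.1.1]
  norm_cast

theorem eigenvalues_le_one (hA : IsQuantumState A) (i : Fin d) : hA.1.1.eigenvalues i ≤ 1 := by
  rw [← hA.sum_eigenvalues]
  exact Finset.single_le_sum (fun j _ => hA.1.eigenvalues_nonneg j) (Finset.mem_univ i)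

theorem re_trace_mul_self_le_one (hA : IsQuantumState A) : (A * A).trace.re ≤ 1 := by
  rw [hA.re_trace_mul_self, ← hA.sum_eigenvalues]
  refine Finset.sum_le_sum fun i _ => ?_
  nlinarith [hA.eigenvalues_le_one i, hA.1.eigenvalues_nonneg i]

/-- The numbers λ - λ² are nonnegative and sum to 0, so every eigenvalue is 0 or 1; since they sum
to 1, exactly one is 1. -/
theorem exists_eigenvalues_eq_single (hA : IsQuantumState A) (h : (A * A).trace.re = 1) :
    ∃ i, ∀ j, hA.1.1.eigenvalues j = if j = i then 1 else 0 := by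
  have h0 : ∑ i, (hA.1.1.eigenvalues i - hA.1.1.eigenvalues i ^ 2) = 0 := by
    rw [Finset.sum_sub_distrib, hA.sum_eigenvalues, ← hA.re_trace_mul_self, h, sub_self]
  have h1 := (Finset.sum_eq_zero_iff_of_nonneg fun i _ => by
    nlinarith [hA.eigenvalues_le_one i, hA.1.eigenvalues_nonneg i]).mp h0
  have h2 : ∀ i, hA.1.1.eigenvalues i = 0 ∨ hA.1.1.eigenvalues i = 1 := fun i => by
    have h3 := h1 i (Finset.mem_univ i)
    have h4 : hA.1.1.eigenvalues i * (hA.1.1.eigenvalues i - 1) = 0 := by linarith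
    exact (mul_eq_zero.mp h4).imp id sub_eq_zero.mp
  obtain ⟨i, hi⟩ : ∃ i, hA.1.1.eigenvalues i = 1 := by
    by_contra hne
    have h5 : ∀ i, hA.1.1.eigenvalues i = 0 := fun i =>
      (h2 i).resolve_right fun h => hne ⟨i, h⟩
    have h6 := hA.sum_eigenvalues
    simp [h5] at h6
  refine ⟨i, fun j => ?_⟩
  by_cases hj : j = i
  · rw [if_pos hj, hj, hi]
  · rw [if_neg hj]
    have h7 := hA.sum_eigenvalues
    rw [← Finset.add_sum_erase _ _ (Finset.mem_univ i), hi] at h7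
    have h8 : ∑ k ∈ Finset.univ.erase i, hA.1.1.eigenvalues k = 0 := by linarith
    exact (Finset.sum_eq_zero_iff_of_nonneg fun k _ => hA.1.eigenvalues_nonneg k).mp h8 j
      (Finset.mem_erase.mpr ⟨hj, Finset.mem_univ j⟩)

theorem rank_eq_one_iff (hA : IsQuantumState A) : A.rank = 1 ↔ (A * A).trace.re = 1 := by
  rw [hA.1.1.rank_eq_card_non_zero_eigs]
  constructor
  · intro h
    obtain ⟨⟨i, hi⟩, hu⟩ := Fintype.card_eq_one_iff.mp h
    have h0 : ∀ j, j ≠ i → hA.1.1.eigenvalues j = 0 := fun j hj => by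
      by_contra hne
      exact hj (congrArg Subtype.val (hu ⟨j, hne⟩))
    have h1 := hA.sum_eigenvalues
    rw [Finset.sum_eq_single i (fun j _ hj => h0 j hj) (by simp)] at h1
    rw [hA.re_trace_mul_self, Finset.sum_eq_single i (fun j _ hj => by simp [h0 j hj]) (by simp),
      h1, one_pow]
  · intro h
    obtain ⟨i, hi⟩ := hA.exists_eigenvalues_eq_single h
    refine Fintype.card_eq_one_iff.mpr ⟨⟨i, by simp [hi]⟩, fun ⟨j, hj⟩ => Subtype.ext ?_⟩
    by_contra hne
    exact hj (by rw [hi, if_neg hne])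

theorem re_trace_sub_mul_sub (hA : IsQuantumState A) (hB : IsQuantumState B) :
    0 ≤ ((A - B) * (A - B)).trace.re ∧ (((A - B) * (A - B)).trace.re = 0 → A = B) := by
  have hH : (A - B)ᴴ = A - B := (hA.1.1.sub hB.1.1).eq
  have h0 := (posSemidef_conjTranspose_mul_self (A - B)).trace_nonneg
  rw [hH] at h0
  refine ⟨(Complex.le_def.mp h0).1, fun h => ?_⟩
  have h1 : ((A - B)ᴴ * (A - B)).trace = 0 := by
    rw [hH]
    exact Complex.ext h (Complex.le_def.mp h0).2.symm
  exact sub_eq_zero.mp (trace_conjTranspose_mul_self_eq_zero_iff.mp h1)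

theorem re_trace_mul_expand (A B : Matrix (Fin d) (Fin d) ℂ) :
    ((A - B) * (A - B)).trace.re =
      (A * A).trace.re + (B * B).trace.re - 2 * (A * B).trace.re := by
  rw [sub_mul, mul_sub, mul_sub, trace_sub, trace_sub, trace_sub, Matrix.trace_mul_comm B A]
  simp only [Complex.sub_re]
  ring

/-- Positivity of tr (A - B)² gives 2 tr AB ≤ tr A² + tr B² ≤ 2. Equality makes the Hilbert–Schmidt
distance vanish, which is `eq_of_re_trace_mul_eq_one`. -/
theorem re_trace_mul_le_one (hA : IsQuantumState A) (hB : IsQuantumState B) :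
    (A * B).trace.re ≤ 1 := by
  have h := (hA.re_trace_sub_mul_sub hB).1
  rw [re_trace_mul_expand] at h
  linarith [hA.re_trace_mul_self_le_one, hB.re_trace_mul_self_le_one]

theorem eq_of_re_trace_mul_eq_one (hA : IsQuantumState A) (hB : IsQuantumState B)
    (h : (A * B).trace.re = 1) : A = B := by
  have h0 := hA.re_trace_sub_mul_sub hB
  refine h0.2 (le_antisymm ?_ h0.1)
  rw [re_trace_mul_expand]
  linarith [hA.re_trace_mul_self_le_one, hB.re_trace_mul_self_le_one]

theorem re_trace_mul_mem_Icc (hA : IsQuantumState A) (hB : IsQuantumState B) :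
    0 ≤ (A * B).trace.re ∧ (A * B).trace.re ≤ 1 :=
  ⟨POVM.re_trace_mul_nonneg hA.1 hB.1, hA.re_trace_mul_le_one hB⟩

/-- The squared moduli of the entries sum to the purity. The bound supplies integrability of
products of entries of the density. -/
theorem norm_apply_le_one (hA : IsQuantumState A) (i j : Fin d) : ‖A i j‖ ≤ 1 := by
  have h : (A * A).trace.re = ∑ i, ∑ j, ‖A i j‖ ^ 2 := by
    rw [trace, Complex.re_sum]
    refine Finset.sum_congr rfl fun i _ => ?_
    rw [diag_apply, Matrix.mul_apply, Complex.re_sum]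
    refine Finset.sum_congr rfl fun j _ => ?_
    rw [← hA.1.1.apply j i, Complex.star_def, Complex.mul_conj, Complex.ofReal_re,
      Complex.normSq_eq_norm_sq]
  have h1 : ‖A i j‖ ^ 2 ≤ ∑ i, ∑ j, ‖A i j‖ ^ 2 :=
    (Finset.single_le_sum (f := fun j => ‖A i j‖ ^ 2) (fun j _ => by positivity)
      (Finset.mem_univ j)).trans
    (Finset.single_le_sum (f := fun i => ∑ j, ‖A i j‖ ^ 2) (fun i _ => by positivity)
      (Finset.mem_univ i))
  have h2 := hA.re_trace_mul_self_le_one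
  nlinarith [norm_nonneg (A i j)]

theorem exists_eq_pureProj (hA : IsQuantumState A) (h : (A * A).trace.re = 1) :
    ∃ ψ, A = pureProj ψ := by
  obtain ⟨i, hi⟩ := hA.exists_eigenvalues_eq_single h
  set v : Fin d → ℂ := (hA.1.1.eigenvectorBasis i).ofLp with hv
  have hn : star v ⬝ᵥ v = 1 := by
    rw [dotProduct_comm, hv, ← EuclideanSpace.inner_eq_star_dotProduct]
    simp
  have h0 : v ≠ 0 := by
    rintro h0
    rw [h0] at hn
    simp at hn
  refine ⟨Projectivization.mk ℂ v h0,
    hA.eq_of_re_trace_mul_eq_one (pureProj_isQuantumState _) ?_⟩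
  have h1 : A *ᵥ v = v := by
    rw [hv, hA.1.1.mulVec_eigenvectorBasis, hi, if_pos rfl, one_smul]
  rw [trace_mul_pureProj_mk, h1, hn]
  simp

end IsQuantumState

theorem pureProj_mul_self {d : ℕ} (ψ : Projectivization ℂ (Fin d → ℂ)) :
    pureProj ψ * pureProj ψ = pureProj ψ := by
  have h : star ψ.rep ⬝ᵥ ψ.rep ≠ 0 := fun h => ψ.rep_nonzero (dotProduct_star_self_eq_zero.mp h)
  rw [pureProj, smul_mul_smul_comm, vecMulVec_mul_vecMulVec, vecMulVec_smul, smul_smul,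
    mul_assoc,
    inv_mul_cancel₀ h, mul_one]

/-! ### The density as a field of states; fidelity as an integral against τ. -/

theorem aemeasurable_trace_mul {X n : Type*} [MeasurableSpace X] [Fintype n] {μ : Measure X}
    {M N : X → Matrix n n ℂ} (hM : ∀ i j, AEMeasurable (fun x => M x i j) μ)
    (hN : ∀ i j, AEMeasurable (fun x => N x i j) μ) :
    AEMeasurable (fun x => (M x * N x).trace) μ := by
  simp only [trace, diag_apply, Matrix.mul_apply]
  exact Finset.aemeasurable_fun_sum _ fun i _ => Finset.aemeasurable_fun_sum _ fun j _ =>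
    (hM i j).mul (hN j i)

/-- Positivity of a quadratic form is a closed condition on the vector. Reducing to countably many
vectors lets their exceptional null sets be united. -/
theorem posSemidef_of_forall_denseRange {d : ℕ} {A : Matrix (Fin d) (Fin d) ℂ} (hA : A.IsHermitian)
    {u : ℕ → Fin d → ℂ} (hu : DenseRange u) (h : ∀ n, 0 ≤ (star (u n) ⬝ᵥ A *ᵥ u n).re) :
    A.PosSemidef := by
  refine .of_dotProduct_mulVec_nonneg hA fun x => ?_
  refine Complex.le_def.mpr ⟨?_, (hA.im_star_dotProduct_mulVec_self x).symm⟩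
  have hc : IsClosed {x : Fin d → ℂ | 0 ≤ (star x ⬝ᵥ A *ᵥ x).re} :=
    isClosed_le continuous_const (by fun_prop)
  exact hu.induction_on (p := fun x => 0 ≤ (star x ⬝ᵥ A *ᵥ x).re) x hc h

namespace POVM

variable {X : Type*} [MeasurableSpace X] {d : ℕ} (F : POVM X d)

theorem aemeasurable_povd (i j : Fin d) : AEMeasurable (fun x => F.povd x i j) F.traceMeasure :=
  (F.integrable_povd i j).1.aemeasurable

theorem integrable_trace_povd_mul (A : Matrix (Fin d) (Fin d) ℂ) :
    Integrable (fun x => (F.povd x * A).trace) F.traceMeasure := by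
  simp only [trace, diag_apply, Matrix.mul_apply]
  exact integrable_finsetSum _ fun i _ => integrable_finsetSum _ fun j _ =>
    (F.integrable_povd i j).mul_const _

theorem setIntegral_trace_povd_mul (A : Matrix (Fin d) (Fin d) ℂ) {S : Set X}
    (hS : MeasurableSet S) :
    ∫ x in S, (F.povd x * A).trace ∂F.traceMeasure = (F.toVectorMeasure S * A).trace := by
  simp only [trace, diag_apply, Matrix.mul_apply]
  rw [integral_finsetSum _ fun i _ => integrable_finsetSum _ fun j _ =>
    ((F.integrable_povd i j).mul_const _).integrableOn]
  refine Finset.sum_congr rfl fun i _ => ?_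
  rw [integral_finsetSum _ fun j _ => ((F.integrable_povd i j).mul_const _).integrableOn]
  refine Finset.sum_congr rfl fun j _ => ?_
  rw [integral_mul_const, F.setIntegral_povd hS]

theorem setIntegral_re_trace_povd_mul (A : Matrix (Fin d) (Fin d) ℂ) {S : Set X}
    (hS : MeasurableSet S) :
    ∫ x in S, (F.povd x * A).trace.re ∂F.traceMeasure = (F.toVectorMeasure S * A).trace.re := by
  rw [← F.setIntegral_trace_povd_mul A hS]
  exact integral_re (F.integrable_trace_povd_mul A).integrableOn

theorem ae_isHermitian_povd : ∀ᵐ x ∂F.traceMeasure, (F.povd x).IsHermitian := by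
  have h : ∀ i j, ∀ᵐ x ∂F.traceMeasure, star (F.povd x j i) = F.povd x i j := by
    intro i j
    refine Integrable.ae_eq_of_forall_setIntegral_eq _ _
      (Complex.conjCLE.toContinuousLinearMap.integrable_comp (F.integrable_povd j i))
      (F.integrable_povd i j) fun S hS _ => ?_
    have h1 : ∫ x in S, (starRingEnd ℂ) (F.povd x j i) ∂F.traceMeasure =
        (starRingEnd ℂ) (∫ x in S, F.povd x j i ∂F.traceMeasure) := integral_conj
    refine h1.trans ?_
    rw [F.setIntegral_povd hS, F.setIntegral_povd hS]
    exact (F.posSemidef S hS).1.apply i j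
  simp only [← ae_all_iff] at h
  filter_upwards [h] with x hx
  exact IsHermitian.ext hx

theorem ae_posSemidef_povd : ∀ᵐ x ∂F.traceMeasure, (F.povd x).PosSemidef := by
  have h : ∀ n, ∀ᵐ x ∂F.traceMeasure,
      0 ≤ (star (TopologicalSpace.denseSeq (Fin d → ℂ) n) ⬝ᵥ
        F.povd x *ᵥ TopologicalSpace.denseSeq (Fin d → ℂ) n).re := by
    intro n
    set v := TopologicalSpace.denseSeq (Fin d → ℂ) n
    have hv : ∀ M : Matrix (Fin d) (Fin d) ℂ,
        (star v ⬝ᵥ M *ᵥ v).re = (M * vecMulVec v (star v)).trace.re := by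
      intro M
      rw [mul_vecMulVec, trace_vecMulVec, dotProduct_comm]
    simp only [hv]
    refine ae_nonneg_of_forall_setIntegral_nonneg
      (F.integrable_trace_povd_mul (vecMulVec v (star v))).re fun S hS _ => ?_
    refine le_of_le_of_eq ?_ (F.setIntegral_re_trace_povd_mul _ hS).symm
    exact re_trace_mul_nonneg (F.posSemidef S hS) (posSemidef_vecMulVec_self_star v)
  filter_upwards [F.ae_isHermitian_povd, ae_all_iff.mpr h] with x hx1 hx2
  exact posSemidef_of_forall_denseRange hx1 (TopologicalSpace.denseRange_denseSeq _) hx2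

theorem traceMeasure_real_apply {S : Set X} (hS : MeasurableSet S) :
    F.traceMeasure.real S = (F.toVectorMeasure S).trace.re := by
  rw [measureReal_def, F.traceMeasure_apply hS, ENNReal.toReal_ofReal]
  exact (Complex.le_def.mp (F.posSemidef S hS).trace_nonneg).1

theorem traceMeasure_real_univ : F.traceMeasure.real Set.univ = d := by
  rw [F.traceMeasure_real_apply MeasurableSet.univ, F.univ_eq_one]
  simp

theorem ae_trace_povd : ∀ᵐ x ∂F.traceMeasure, (F.povd x).trace = 1 := by
  refine Integrable.ae_eq_of_forall_setIntegral_eq (fun x => (F.povd x).trace) (fun _ => 1)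
    (by simpa using F.integrable_trace_povd_mul 1) (integrable_const _) fun S hS _ => ?_
  have h := F.setIntegral_trace_povd_mul 1 hS
  simp only [Matrix.mul_one] at h
  rw [h, setIntegral_const, F.traceMeasure_real_apply hS]
  refine Complex.ext (by simp) ?_
  simpa using (Complex.le_def.mp (F.posSemidef S hS).trace_nonneg).2.symm

theorem ae_isQuantumState_povd : ∀ᵐ x ∂F.traceMeasure, IsQuantumState (F.povd x) := by
  filter_upwards [F.ae_posSemidef_povd, F.ae_trace_povd] with x h1 h2 using ⟨h1, h2⟩

theorem traceMulMeasure_eq_withDensity (A : Matrix (Fin d) (Fin d) ℂ) (hA : A.PosSemidef) :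
    F.traceMulMeasure A hA =
      F.traceMeasure.withDensity fun x => ENNReal.ofReal (F.povd x * A).trace.re := by
  ext S hS
  rw [F.traceMulMeasure_apply A hA hS, withDensity_apply _ hS,
    ← F.setIntegral_re_trace_povd_mul A hS]
  refine ofReal_integral_eq_lintegral_ofReal (F.integrable_trace_povd_mul A).re.integrableOn ?_
  filter_upwards [ae_restrict_of_ae F.ae_posSemidef_povd] with x hx
  exact re_trace_mul_nonneg hx hA

theorem fidelity_eq_integral (ρ : X → Matrix (Fin d) (Fin d) ℂ)
    (ψ : Projectivization ℂ (Fin d → ℂ)) :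
    F.fidelity ρ ψ = ∫ x, (F.povd x * pureProj ψ).trace.re * (ρ x * pureProj ψ).trace.re
      ∂F.traceMeasure := by
  rw [fidelity, traceMulMeasure_eq_withDensity, integral_withDensity_eq_integral_toReal_smul₀]
  · refine integral_congr_ae ?_
    filter_upwards [F.ae_posSemidef_povd] with x hx
    rw [ENNReal.toReal_ofReal (re_trace_mul_nonneg hx (pureProj_posSemidef ψ)), smul_eq_mul]
  · exact (F.integrable_trace_povd_mul _).re.1.aemeasurable.ennreal_ofReal
  · simp

theorem fidelity_nonneg {ρ : X → Matrix (Fin d) (Fin d) ℂ} (hρ : ∀ x, IsQuantumState (ρ x))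
    (ψ : Projectivization ℂ (Fin d → ℂ)) : 0 ≤ F.fidelity ρ ψ :=
  integral_nonneg fun x => re_trace_mul_nonneg (hρ x).1 (pureProj_posSemidef ψ)

theorem integrable_re_trace_mul {M N : X → Matrix (Fin d) (Fin d) ℂ}
    (hM : ∀ᵐ x ∂F.traceMeasure, IsQuantumState (M x))
    (hMm : ∀ i j, AEMeasurable (fun x => M x i j) F.traceMeasure)
    (hN : ∀ᵐ x ∂F.traceMeasure, IsQuantumState (N x))
    (hNm : ∀ i j, AEMeasurable (fun x => N x i j) F.traceMeasure) :
    Integrable (fun x => (M x * N x).trace.re) F.traceMeasure := by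
  refine .of_bound (Complex.measurable_re.comp_aemeasurable
    (aemeasurable_trace_mul hMm hNm)).aestronglyMeasurable 1 ?_
  filter_upwards [hM, hN] with x h1 h2
  obtain ⟨h3, h4⟩ := h1.re_trace_mul_mem_Icc h2
  rwa [Real.norm_of_nonneg h3]

theorem integrable_fidelity {ρ : X → Matrix (Fin d) (Fin d) ℂ} (hρ : ∀ x, IsQuantumState (ρ x))
    (hρm : ∀ i j, AEMeasurable (fun x => ρ x i j) F.traceMeasure)
    (ψ : Projectivization ℂ (Fin d → ℂ)) :
    Integrable (fun x => (F.povd x * pureProj ψ).trace.re * (ρ x * pureProj ψ).trace.re)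
      F.traceMeasure := by
  have hψ : ∀ᵐ x ∂F.traceMeasure, IsQuantumState (pureProj ψ) :=
    .of_forall fun _ => pureProj_isQuantumState ψ
  have h1 := F.integrable_re_trace_mul F.ae_isQuantumState_povd F.aemeasurable_povd hψ
    fun _ _ => aemeasurable_const
  have h2 := F.integrable_re_trace_mul (.of_forall hρ) hρm hψ fun _ _ => aemeasurable_const
  refine h1.mul_bdd (c := 1) h2.1 ?_
  filter_upwards with x
  obtain ⟨h3, h4⟩ := (hρ x).re_trace_mul_mem_Icc (pureProj_isQuantumState ψ)
  rwa [Real.norm_of_nonneg h3]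

/-- The average of the fidelity over a weighted 2-design. -/
theorem sum_mul_fidelity {ρ : X → Matrix (Fin d) (Fin d) ℂ} (hρ : ∀ x, IsQuantumState (ρ x))
    (hρm : ∀ i j, AEMeasurable (fun x => ρ x i j) F.traceMeasure)
    {ι : Type*} [Fintype ι] {w : ι → ℝ} {φ : ι → Projectivization ℂ (Fin d → ℂ)}
    (hw : ∀ A B : Matrix (Fin d) (Fin d) ℂ,
        ∑ i, (w i : ℂ) * ((A * pureProj (φ i)).trace * (B * pureProj (φ i)).trace) =
          A.trace * B.trace + (A * B).trace) :
    ∑ i, w i * F.fidelity ρ (φ i) = d + ∫ x, (F.povd x * ρ x).trace.re ∂F.traceMeasure := by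
  simp only [fidelity_eq_integral, ← integral_const_mul]
  rw [← integral_finsetSum _ fun i _ => (F.integrable_fidelity hρ hρm (φ i)).const_mul _]
  -- Pointwise, the design yields tr P tr ρ + tr Pρ = 1 + tr Pρ; the 1 integrates to τ(X) = d.
  have h1 : (d : ℝ) = ∫ _, 1 ∂F.traceMeasure := by simp [F.traceMeasure_real_univ]
  rw [h1, ← integral_add (integrable_const _) (F.integrable_re_trace_mul F.ae_isQuantumState_povd
    F.aemeasurable_povd (.of_forall hρ) hρm)]
  refine integral_congr_ae ?_
  filter_upwards [F.ae_isQuantumState_povd] with x hx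
  have h2 := hw (F.povd x) (ρ x)
  rw [hx.2, (hρ x).2] at h2
  have h3 : ∀ i, (w i : ℂ) * ((F.povd x * pureProj (φ i)).trace * (ρ x * pureProj (φ i)).trace) =
      ((w i * ((F.povd x * pureProj (φ i)).trace.re * (ρ x * pureProj (φ i)).trace.re) : ℝ) : ℂ) := by
    intro i
    rw [Complex.ofReal_mul, Complex.ofReal_mul,
      ofReal_re_trace_mul hx.1.1 (pureProj_posSemidef _).1,
      ofReal_re_trace_mul (hρ x).1.1 (pureProj_posSemidef _).1]
  simp_rw [h3] at h2
  rw [← ofReal_re_trace_mul hx.1.1 (hρ x).1.1] at h2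
  rw [mul_one] at h2
  exact_mod_cast h2

end POVM

/-! ### The second-moment tensor ∫ P ⊗ P dτ. -/

/-- Separates the entries of M ⊗ M from those of B ⊗ C, so that integrating over M involves only the
second-moment tensor. -/
theorem trace_mul_mul_trace_mul {n : Type*} [Fintype n] (M B C : Matrix n n ℂ) :
    (M * B).trace * (M * C).trace = ∑ p : n × n × n × n,
      M p.2.1 p.1 * M p.2.2.2 p.2.2.1 * (B p.1 p.2.1 * C p.2.2.1 p.2.2.2) := by
  rw [Matrix.trace_mul_comm M B, Matrix.trace_mul_comm M C, mul_comm]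
  simp only [trace, diag_apply, Matrix.mul_apply, Fintype.sum_prod_type, Finset.sum_mul,
    Finset.mul_sum]
  refine Finset.sum_congr rfl fun i _ => Finset.sum_congr rfl fun j _ =>
    Finset.sum_congr rfl fun k _ => Finset.sum_congr rfl fun l _ => ?_
  ring

theorem trace_mul_trace_add_trace_mul {n : Type*} [Fintype n] [DecidableEq n]
    (B C : Matrix n n ℂ) :
    B.trace * C.trace + (B * C).trace = ∑ p : n × n × n × n,
      ((1 : Matrix n n ℂ) p.2.1 p.1 * (1 : Matrix n n ℂ) p.2.2.2 p.2.2.1 +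
        (1 : Matrix n n ℂ) p.2.1 p.2.2.1 * (1 : Matrix n n ℂ) p.2.2.2 p.1) *
          (B p.1 p.2.1 * C p.2.2.1 p.2.2.2) := by
  simp [Fintype.sum_prod_type, Matrix.one_apply, add_mul, Finset.sum_add_distrib, trace,
    Matrix.mul_apply, Finset.sum_mul_sum]

/-- The entrywise form of the 2-design property. -/
theorem sum_pureProj_apply_mul {d : ℕ} {ι : Type*} [Fintype ι] {w : ι → ℝ}
    {φ : ι → Projectivization ℂ (Fin d → ℂ)}
    (hw : ∀ A B : Matrix (Fin d) (Fin d) ℂ,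
        ∑ i, (w i : ℂ) * ((A * pureProj (φ i)).trace * (B * pureProj (φ i)).trace) =
          A.trace * B.trace + (A * B).trace) (i j k l : Fin d) :
    ∑ m, (w m : ℂ) * (pureProj (φ m) i j * pureProj (φ m) k l) =
      (1 : Matrix (Fin d) (Fin d) ℂ) i j * (1 : Matrix (Fin d) (Fin d) ℂ) k l +
        (1 : Matrix (Fin d) (Fin d) ℂ) i l * (1 : Matrix (Fin d) (Fin d) ℂ) k j := by
  have h := hw (Matrix.single j i 1) (Matrix.single l k 1)
  simp only [Matrix.trace_single_mul, one_mul, smul_eq_mul] at h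
  rw [h]
  congr 1
  · rcases eq_or_ne i j with rfl | hij
    · rcases eq_or_ne k l with rfl | hkl
      · simp
      · simp [hkl, trace_single_eq_of_ne _ _ _ hkl.symm]
    · simp [hij, trace_single_eq_of_ne _ _ _ hij.symm]
  · simp only [Matrix.single_apply, Matrix.one_apply, ite_and, mul_ite, mul_one, mul_zero,
      eq_comm (a := l)]
    split_ifs <;> rfl

namespace POVM

variable {X : Type*} [MeasurableSpace X] {d : ℕ} (F : POVM X d)

theorem integrable_povd_mul_povd (i j k l : Fin d) :
    Integrable (fun x => F.povd x i j * F.povd x k l) F.traceMeasure := by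
  refine (F.integrable_povd i j).mul_bdd (c := 1) (F.integrable_povd k l).1 ?_
  filter_upwards [F.ae_isQuantumState_povd] with x hx using hx.norm_apply_le_one k l

theorem integral_trace_povd_mul_mul (B C : Matrix (Fin d) (Fin d) ℂ) :
    ∫ x, (F.povd x * B).trace * (F.povd x * C).trace ∂F.traceMeasure =
      ∑ p : Fin d × Fin d × Fin d × Fin d,
        (∫ x, F.povd x p.2.1 p.1 * F.povd x p.2.2.2 p.2.2.1 ∂F.traceMeasure) *
          (B p.1 p.2.1 * C p.2.2.1 p.2.2.2) := by
  simp_rw [trace_mul_mul_trace_mul, ← integral_mul_const]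
  exact integral_finsetSum _ fun p _ => (F.integrable_povd_mul_povd _ _ _ _).mul_const _

/-- If the density consists of pure states and the second moments `∫ tr[P π]² dτ` equal `2a` for
all pure states `π`, then `∫ P ⊗ P dτ` is `a` times the sum of the identity and the swap. -/
theorem integral_povd_mul_povd {a : ℝ}
    (hpure : ∀ᵐ x ∂F.traceMeasure, ∃ ψ, F.povd x = pureProj ψ)
    (ha : ∀ ψ : Projectivization ℂ (Fin d → ℂ), ∫ x, (F.povd x * pureProj ψ).trace *
      (F.povd x * pureProj ψ).trace ∂F.traceMeasure = 2 * a) (i j k l : Fin d) :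
    ∫ x, F.povd x i j * F.povd x k l ∂F.traceMeasure =
      a * ((1 : Matrix (Fin d) (Fin d) ℂ) i j * (1 : Matrix (Fin d) (Fin d) ℂ) k l +
        (1 : Matrix (Fin d) (Fin d) ℂ) i l * (1 : Matrix (Fin d) (Fin d) ℂ) k j) := by
  set E : Matrix (Fin d) (Fin d) ℂ := 1 with hE
  have hEs : ∀ i j, (starRingEnd ℂ) (E i j) = E j i := fun i j =>
    (Matrix.isHermitian_one (n := Fin d) (α := ℂ)).apply j i
  -- K is the difference of the two tensors. It annihilates every π ⊗ π, and both tensors are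
  -- superpositions of such products, so K is orthogonal to itself.
  let K : Fin d → Fin d → Fin d → Fin d → ℂ := fun i j k l =>
    (∫ x, F.povd x i j * F.povd x k l ∂F.traceMeasure) - a * (E i j * E k l + E i l * E k j)
  have hKs : ∀ i j k l, (starRingEnd ℂ) (K i j k l) = K j i l k := by
    intro i j k l
    simp only [K, map_sub, map_mul, map_add, Complex.conj_ofReal, hEs]
    rw [← integral_conj]
    congr 1
    · refine integral_congr_ae ?_
      filter_upwards [F.ae_isHermitian_povd] with x hx
      rw [map_mul]
      exact congrArg₂ _ (hx.apply j i) (hx.apply l k)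
    · ring
  have hL : ∀ ψ : Projectivization ℂ (Fin d → ℂ), ∑ p : Fin d × Fin d × Fin d × Fin d,
      K p.2.1 p.1 p.2.2.2 p.2.2.1 * (pureProj ψ p.1 p.2.1 * pureProj ψ p.2.2.1 p.2.2.2) = 0 := by
    intro ψ
    have hp : (pureProj ψ).trace = 1 := (pureProj_isQuantumState ψ).2
    have h1 := F.integral_trace_povd_mul_mul (pureProj ψ) (pureProj ψ)
    have h2 := trace_mul_trace_add_trace_mul (pureProj ψ) (pureProj ψ)
    rw [ha ψ] at h1
    simp only [K, sub_mul, Finset.sum_sub_distrib, mul_assoc (a : ℂ), ← Finset.mul_sum]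
    rw [← h1, ← h2, pureProj_mul_self, hp]
    ring
  have hψ : ∃ ψ : Projectivization ℂ (Fin d → ℂ), True :=
    ⟨Projectivization.mk ℂ (Pi.single i 1) (fun h => by simpa using congrFun h i), trivial⟩
  obtain ⟨ψ₀, -⟩ := hψ
  obtain ⟨ι, _, w, φ, i₀, -, -, -, -, hw⟩ := exists_weighted_two_design ψ₀
  -- The 2-design writes identity plus swap as a weighted sum of π ⊗ π.
  have hKE : ∑ p : Fin d × Fin d × Fin d × Fin d, K p.2.1 p.1 p.2.2.2 p.2.2.1 *
      (E p.1 p.2.1 * E p.2.2.1 p.2.2.2 + E p.1 p.2.2.2 * E p.2.2.1 p.2.1) = 0 := by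
    simp only [hE, ← sum_pureProj_apply_mul hw, Finset.mul_sum]
    rw [Finset.sum_comm]
    refine Finset.sum_eq_zero fun m _ => ?_
    simp only [mul_left_comm _ (w m : ℂ)]
    rw [← Finset.mul_sum, hL, mul_zero]
  -- Purity of the density makes the integrand P ⊗ P itself of the form π ⊗ π almost everywhere.
  have hKG : ∑ p : Fin d × Fin d × Fin d × Fin d, K p.2.1 p.1 p.2.2.2 p.2.2.1 *
      (∫ x, F.povd x p.1 p.2.1 * F.povd x p.2.2.1 p.2.2.2 ∂F.traceMeasure) = 0 := by
    simp only [← integral_const_mul]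
    rw [← integral_finsetSum _ fun p _ => (F.integrable_povd_mul_povd _ _ _ _).const_mul _]
    refine integral_eq_zero_of_ae ?_
    filter_upwards [hpure] with x ⟨ψ, hψ⟩
    rw [hψ]
    exact hL ψ
  have hKK : ∑ p : Fin d × Fin d × Fin d × Fin d,
      ‖K p.1 p.2.1 p.2.2.1 p.2.2.2‖ ^ 2 = 0 := by
    have h : ∑ p : Fin d × Fin d × Fin d × Fin d,
        K p.2.1 p.1 p.2.2.2 p.2.2.1 * K p.1 p.2.1 p.2.2.1 p.2.2.2 = 0 := by
      have h0 : ∀ p : Fin d × Fin d × Fin d × Fin d,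
          K p.2.1 p.1 p.2.2.2 p.2.2.1 * K p.1 p.2.1 p.2.2.1 p.2.2.2 =
          K p.2.1 p.1 p.2.2.2 p.2.2.1 *
            (∫ x, F.povd x p.1 p.2.1 * F.povd x p.2.2.1 p.2.2.2 ∂F.traceMeasure) -
          a * (K p.2.1 p.1 p.2.2.2 p.2.2.1 *
            (E p.1 p.2.1 * E p.2.2.1 p.2.2.2 + E p.1 p.2.2.2 * E p.2.2.1 p.2.1)) := by
        intro p
        simp only [K]
        ring
      simp only [h0, Finset.sum_sub_distrib, ← Finset.mul_sum]
      rw [hKG, hKE, mul_zero, sub_zero]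
    -- The Hermitian symmetry `hKs` turns the bilinear pairing of K with itself into a sum of
    -- squared moduli.
    have h1 : ∀ p : Fin d × Fin d × Fin d × Fin d,
        K p.2.1 p.1 p.2.2.2 p.2.2.1 * K p.1 p.2.1 p.2.2.1 p.2.2.2 =
          ((‖K p.1 p.2.1 p.2.2.1 p.2.2.2‖ ^ 2 : ℝ) : ℂ) := by
      intro p
      rw [← hKs p.1, ← Complex.normSq_eq_conj_mul_self, Complex.normSq_eq_norm_sq]
    simp only [h1] at h
    exact_mod_cast h
  have hK0 := (Finset.sum_eq_zero_iff_of_nonneg fun p _ => by positivity).mp hKK (i, j, k, l)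
    (Finset.mem_univ _)
  exact sub_eq_zero.mp (norm_eq_zero.mp (pow_eq_zero_iff two_ne_zero |>.mp hK0))

theorem integral_trace_povd_mul (A : Matrix (Fin d) (Fin d) ℂ) :
    ∫ x, (F.povd x * A).trace ∂F.traceMeasure = A.trace := by
  have h := F.setIntegral_trace_povd_mul A MeasurableSet.univ
  rwa [setIntegral_univ, F.univ_eq_one, Matrix.one_mul] at h

/-- The frame operator applied to a traceless Hermitian matrix. -/
theorem integral_trace_tracelessPovd_mul (A : Matrix (Fin d) (Fin d) ℂ)
    (hA0 : A.trace = 0) (i j : Fin d) :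
    ∫ x, ((F.tracelessPovd x)ᴴ * A).trace * F.tracelessPovd x i j ∂F.traceMeasure =
      ∫ x, (F.povd x * A).trace * F.povd x i j ∂F.traceMeasure := by
  have h1 : ∫ x, ((F.tracelessPovd x)ᴴ * A).trace * F.tracelessPovd x i j ∂F.traceMeasure =
      ∫ x, ((F.povd x * A).trace * F.povd x i j -
        (F.povd x * A).trace * ((d : ℂ)⁻¹ • (1 : Matrix (Fin d) (Fin d) ℂ)) i j)
          ∂F.traceMeasure := by
    refine integral_congr_ae ?_
    filter_upwards [F.ae_isHermitian_povd] with x hx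
    have h2 : ((F.tracelessPovd x)ᴴ * A).trace = (F.povd x * A).trace := by
      rw [tracelessPovd, conjTranspose_sub, hx.eq, conjTranspose_smul, conjTranspose_one, sub_mul,
        trace_sub, smul_mul_assoc, Matrix.one_mul, trace_smul, hA0, smul_zero, sub_zero]
    rw [h2, tracelessPovd, Matrix.sub_apply, mul_sub]
  -- The I/d correction drops out because ∫ P dτ = I and A is traceless.
  rw [h1, integral_sub, integral_mul_const, integral_trace_povd_mul, hA0, zero_mul, sub_zero]
  · simp only [trace, diag_apply, Matrix.mul_apply, Finset.sum_mul]
    refine integrable_finsetSum _ fun k _ => integrable_finsetSum _ fun l _ => ?_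
    simp only [mul_right_comm _ (A _ _)]
    exact (F.integrable_povd_mul_povd _ _ _ _).mul_const _
  · exact (F.integrable_trace_povd_mul A).mul_const _

end POVM

/-! ### Tightness, second moments and constant fidelity. -/

namespace POVM

variable {X : Type*} [MeasurableSpace X] {d : ℕ} (F : POVM X d)

theorem ofReal_fidelity_of_ae_eq {ρ : X → Matrix (Fin d) (Fin d) ℂ}
    (h : ρ =ᵐ[F.traceMeasure] F.povd) (ψ : Projectivization ℂ (Fin d → ℂ)) :
    (F.fidelity ρ ψ : ℂ) = ∫ x, (F.povd x * pureProj ψ).trace * (F.povd x * pureProj ψ).trace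
      ∂F.traceMeasure := by
  rw [fidelity_eq_integral, ← integral_complex_ofReal]
  refine integral_congr_ae ?_
  filter_upwards [h, F.ae_isHermitian_povd] with x hx hH
  rw [hx, Complex.ofReal_mul, ofReal_re_trace_mul hH (pureProj_posSemidef ψ).1]

/-- Contracting the tensor with A, the identity part gives tr A = 0 and the swap part gives A back,
so the frame constant is a. -/
theorem isTightIC_of_second_moment {a : ℝ} (h0 : 0 < a)
    (h : ∀ i j k l, ∫ x, F.povd x i j * F.povd x k l ∂F.traceMeasure =
      a * ((1 : Matrix (Fin d) (Fin d) ℂ) i j * (1 : Matrix (Fin d) (Fin d) ℂ) k l +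
        (1 : Matrix (Fin d) (Fin d) ℂ) i l * (1 : Matrix (Fin d) (Fin d) ℂ) k j)) :
    F.IsTightIC := by
  refine ⟨a, h0, fun A _ hA0 i j => ?_⟩
  rw [F.integral_trace_tracelessPovd_mul A hA0]
  have h1 := F.integral_trace_povd_mul_mul A (Matrix.single j i 1)
  simp only [h, mul_assoc (a : ℂ), ← Finset.mul_sum] at h1
  rw [← trace_mul_trace_add_trace_mul, hA0, zero_mul, zero_add] at h1
  simpa [Matrix.trace_mul_single] using h1

/-- Apply the frame identity to A = π - I/d and pair the result with π. As tr P = 1 and ∫ tr[Pπ] dτ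
= 1, the left side is f(ψ) - 1/d, while the right side is a(1 - 1/d), independent of ψ. -/
theorem IsTightIC.exists_fidelity_eq {F : POVM X d} (hd : 1 ≤ d) (hF : F.IsTightIC)
    {ρ : X → Matrix (Fin d) (Fin d) ℂ} (h : ρ =ᵐ[F.traceMeasure] F.povd) :
    ∃ c : ℝ, ∀ ψ, F.fidelity ρ ψ = c := by
  obtain ⟨a, -, ha⟩ := hF
  refine ⟨a * (1 - (d : ℝ)⁻¹) + (d : ℝ)⁻¹, fun ψ => ?_⟩
  have hp := (pureProj_isQuantumState ψ).2
  set A : Matrix (Fin d) (Fin d) ℂ := pureProj ψ - (d : ℂ)⁻¹ • (1 : Matrix (Fin d) (Fin d) ℂ) with hA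
  have hd0 : (d : ℂ) ≠ 0 := by exact_mod_cast (by omega : d ≠ 0)
  have hA0 : A.trace = 0 := by
    rw [hA, trace_sub, hp, trace_smul, trace_one]
    simp [hd0]
  have hAH : A.IsHermitian := by
    rw [IsHermitian, hA, conjTranspose_sub, (pureProj_posSemidef ψ).1.eq, conjTranspose_smul]
    simp
  have h1 : ∀ i j, ∫ x, (F.povd x * A).trace * F.povd x i j ∂F.traceMeasure = a * A i j :=
    fun i j => (F.integral_trace_tracelessPovd_mul A hA0 i j).symm.trans (ha A hAH hA0 i j)
  have hint : ∀ i j, Integrable (fun x => (F.povd x * A).trace * F.povd x i j)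
      F.traceMeasure := by
    intro i j
    refine (F.integrable_trace_povd_mul A).mul_bdd (c := 1) (F.integrable_povd i j).1 ?_
    filter_upwards [F.ae_isQuantumState_povd] with x hx using hx.norm_apply_le_one i j
  have h2 : ∫ x, (F.povd x * A).trace * (F.povd x * pureProj ψ).trace ∂F.traceMeasure =
      a * (A * pureProj ψ).trace := by
    have hs : ∀ M : Matrix (Fin d) (Fin d) ℂ, (M * pureProj ψ).trace =
        ∑ i, ∑ j, M i j * pureProj ψ j i := fun M => rfl
    simp only [hs (F.povd _), hs A, Finset.mul_sum, ← mul_assoc]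
    rw [integral_finsetSum _ fun i _ => integrable_finsetSum _ fun j _ =>
      (hint i j).mul_const _]
    refine Finset.sum_congr rfl fun i _ => ?_
    rw [integral_finsetSum _ fun j _ => (hint i j).mul_const _]
    refine Finset.sum_congr rfl fun j _ => ?_
    rw [integral_mul_const, h1]
  have h3 : (A * pureProj ψ).trace = 1 - (d : ℂ)⁻¹ := by
    rw [hA, sub_mul, pureProj_mul_self, trace_sub, smul_mul_assoc, Matrix.one_mul, trace_smul, hp]
    simp
  have h4 : ∫ x, (F.povd x * A).trace * (F.povd x * pureProj ψ).trace ∂F.traceMeasure =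
      F.fidelity ρ ψ - (d : ℂ)⁻¹ := by
    rw [F.ofReal_fidelity_of_ae_eq h]
    have h5 : (d : ℂ)⁻¹ = ∫ x, (d : ℂ)⁻¹ * (F.povd x * pureProj ψ).trace ∂F.traceMeasure := by
      rw [integral_const_mul, F.integral_trace_povd_mul, hp, mul_one]
    conv_rhs => rw [h5]
    rw [← integral_sub]
    · refine integral_congr_ae ?_
      filter_upwards [F.ae_trace_povd] with x hx
      rw [hA, mul_sub, trace_sub, mul_smul_comm, Matrix.mul_one, trace_smul, hx, smul_eq_mul]
      ring
    · simp only [trace_mul_mul_trace_mul]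
      exact integrable_finsetSum _ fun p _ => (F.integrable_povd_mul_povd _ _ _ _).mul_const _
    · exact (F.integrable_trace_povd_mul _).const_mul _
  rw [h4, h3] at h2
  have h6 : ((F.fidelity ρ ψ : ℝ) : ℂ) = ((a * (1 - (d : ℝ)⁻¹) + (d : ℝ)⁻¹ : ℝ) : ℂ) := by
    push_cast
    linear_combination h2
  exact_mod_cast h6

end POVM

/-! ### The bound and its equality case. -/

theorem theorem20 {X : Type*} [MeasurableSpace X] {d : ℕ} (hd : 1 ≤ d)
    (F : POVM X d) (ρ : X → Matrix (Fin d) (Fin d) ℂ)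
    (hρ : ∀ x, IsQuantumState (ρ x))
    (hρm : ∀ i j, AEMeasurable (fun x => ρ x i j) F.traceMeasure) :
    F.worstCaseFidelity ρ ≤ 2 / ((d : ℝ) + 1) ∧
      (F.worstCaseFidelity ρ = 2 / ((d : ℝ) + 1) ↔
        (F.IsTightIC ∧ F.IsRankOne) ∧ ρ =ᵐ[F.traceMeasure] F.povd) := by
  have hd0 : (0 : ℝ) < d := by exact_mod_cast hd
  let ψ₀ : Projectivization ℂ (Fin d → ℂ) :=
    Projectivization.mk ℂ (Pi.single ⟨0, hd⟩ 1) fun h => by simpa using congrFun h ⟨0, hd⟩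
  have : Nonempty (Projectivization ℂ (Fin d → ℂ)) := ⟨ψ₀⟩
  have hinf : ∀ ψ, F.worstCaseFidelity ρ ≤ F.fidelity ρ ψ := fun ψ =>
    ciInf_le ⟨0, by rintro _ ⟨ψ, rfl⟩; exact F.fidelity_nonneg hρ ψ⟩ ψ
  have hint := F.integrable_re_trace_mul F.ae_isQuantumState_povd F.aemeasurable_povd
    (.of_forall hρ) hρm
  have hle : ∀ᵐ x ∂F.traceMeasure, (F.povd x * ρ x).trace.re ≤ 1 := by
    filter_upwards [F.ae_isQuantumState_povd] with x hx using hx.re_trace_mul_le_one (hρ x)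
  have hd1 : (d : ℝ) = ∫ _, 1 ∂F.traceMeasure := by simp [F.traceMeasure_real_univ]
  have hI : ∫ x, (F.povd x * ρ x).trace.re ∂F.traceMeasure ≤ d := by
    conv_rhs => rw [hd1]
    exact integral_mono_ae hint (integrable_const _) hle
  -- In a design through ψ, every excess over the infimum is nonnegative. Retaining the excess at ψ
  -- gives the bound and also controls the equality case at ψ.
  have havg : ∀ ψ, ∃ w : ℝ, 0 < w ∧ w * (F.fidelity ρ ψ - F.worstCaseFidelity ρ) +
      d * (d + 1) * F.worstCaseFidelity ρ ≤
        d + ∫ x, (F.povd x * ρ x).trace.re ∂F.traceMeasure := by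
    intro ψ
    obtain ⟨ι, _, w, φ, i₀, hw0, hwi, rfl, hsum, hw⟩ := exists_weighted_two_design ψ
    refine ⟨w i₀, hwi, ?_⟩
    rw [← F.sum_mul_fidelity hρ hρm hw, ← hsum, Finset.sum_mul]
    have h1 := Finset.single_le_sum
      (f := fun i => w i * (F.fidelity ρ (φ i) - F.worstCaseFidelity ρ))
      (fun i _ => mul_nonneg (hw0 i) (sub_nonneg.mpr (hinf _))) (Finset.mem_univ i₀)
    simp only [mul_sub, Finset.sum_sub_distrib] at h1 ⊢
    linarith
  have hbound : F.worstCaseFidelity ρ ≤ 2 / ((d : ℝ) + 1) := by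
    obtain ⟨w, hw, h⟩ := havg ψ₀
    have h1 := mul_nonneg hw.le (sub_nonneg.mpr (hinf ψ₀))
    rw [le_div_iff₀ (by positivity)]
    refine le_of_mul_le_mul_left ?_ hd0
    linarith
  refine ⟨hbound, fun heq => ?_, fun ⟨⟨htight, hrank⟩, hae⟩ => ?_⟩
  · have hc : d * ((d : ℝ) + 1) * F.worstCaseFidelity ρ = 2 * d := by
      rw [heq]
      field_simp
    have hconst : ∀ ψ, F.fidelity ρ ψ = 2 / ((d : ℝ) + 1) := by
      intro ψ
      obtain ⟨w, hw, h⟩ := havg ψ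
      rw [hc] at h
      have h1 : w * (F.fidelity ρ ψ - F.worstCaseFidelity ρ) ≤ 0 := by linarith
      have h2 := nonpos_of_mul_nonpos_right h1 hw
      linarith [hinf ψ]
    have hI' : ∫ x, (1 - (F.povd x * ρ x).trace.re) ∂F.traceMeasure = 0 := by
      obtain ⟨w, hw, h⟩ := havg ψ₀
      rw [hc] at h
      have h1 := mul_nonneg hw.le (sub_nonneg.mpr (hinf ψ₀))
      rw [integral_sub (integrable_const _) hint, ← hd1]
      linarith
    have hone : ∀ᵐ x ∂F.traceMeasure, (F.povd x * ρ x).trace.re = 1 := by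
      have h := (integral_eq_zero_iff_of_nonneg_ae (by
        filter_upwards [hle] with x hx using sub_nonneg.mpr hx)
        ((integrable_const _).sub hint)).mp hI'
      filter_upwards [h] with x hx using (sub_eq_zero.mp hx).symm
    have hae : ρ =ᵐ[F.traceMeasure] F.povd := by
      filter_upwards [hone, F.ae_isQuantumState_povd] with x h1 h2
      exact (h2.eq_of_re_trace_mul_eq_one (hρ x) h1).symm
    have hpp : ∀ᵐ x ∂F.traceMeasure, (F.povd x * F.povd x).trace.re = 1 := by
      filter_upwards [hone, hae] with x h1 h2
      rwa [h2] at h1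
    refine ⟨⟨?_, ?_⟩, hae⟩
    -- Here 2a must equal the constant fidelity 2/(d+1).
    · refine F.isTightIC_of_second_moment (a := 1 / ((d : ℝ) + 1)) (by positivity)
        (F.integral_povd_mul_povd ?_ fun ψ => ?_)
      · filter_upwards [hpp, F.ae_isQuantumState_povd] with x h1 h2
          using h2.exists_eq_pureProj h1
      · rw [← F.ofReal_fidelity_of_ae_eq hae, hconst]
        push_cast
        ring
    · filter_upwards [hpp, F.ae_isQuantumState_povd] with x h1 h2 using h2.rank_eq_one_iff.mpr h1
  · obtain ⟨c, hc⟩ := htight.exists_fidelity_eq hd hae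
    have hwc : F.worstCaseFidelity ρ = c := by
      rw [POVM.worstCaseFidelity]
      simp only [hc, ciInf_const]
    -- Any one design fixes the constant c: d(d+1)c = d + ∫ tr P² dτ = 2d, the last equality by rank
    -- one.
    obtain ⟨ι, _, w, φ, i₀, -, -, -, hsum, hw⟩ := exists_weighted_two_design ψ₀
    have h1 := F.sum_mul_fidelity hρ hρm hw
    have h2 : ∫ x, (F.povd x * ρ x).trace.re ∂F.traceMeasure = d := by
      conv_rhs => rw [hd1]
      refine integral_congr_ae ?_
      filter_upwards [hae, hrank, F.ae_isQuantumState_povd] with x hx1 hx2 hx3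
      rw [hx1]
      exact hx3.rank_eq_one_iff.mp hx2
    simp only [hc] at h1
    rw [← Finset.sum_mul, hsum, h2] at h1
    rw [hwc, eq_div_iff (by positivity)]
    refine mul_left_cancel₀ hd0.ne' ?_
    linarith
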